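/- Let $n,t_s,t_a,\Delta$ be natural numbers with $\Delta>0$, $t_s>0$, $t_a\le t_s<n$ and $n\le 3t_s$. Let $V_{\mathrm{in}}$ be a nonempty, at most countable set of inputs and $V_{\mathrm{out}}$ any set of outputs. An input configuration $I$ assigns an input in $V_{\mathrm{in}}$ to each party of a set of at least $n-t_s$ of the $n$ parties (the honest ones; the others are corrupted). A validity property $V$ maps every input configuration $I$ to a set $V(I)\subseteq V_{\mathrm{out}}$ of valid outputs; it is trivial if $\bigcap_I V(I)\neq\emptyset$. Model. Time is divided into ticks and every two parties are joined by an authenticated channel. There is no cryptographic setup: the only randomness of a protocol is a public random string, known also to the adversary, and private random strings of the parties, independent of each other and of the public one (arbitrary probability spaces). Messages come from a countable set. A party's messages and its irrevocable decision are determined by its input, the public string, its private string and the messages received in each of its steps so far. The adversary is computationally unbounded, static (the corrupted parties are fixed in advance) and has its own coins; it sees the public string and all messages sent to corrupted parties, sends arbitrary messages on behalf of the corrupted parties, and controls when parties make steps and when messages are delivered. In a synchronous network every honest party makes a step at every tick and every message arrives within $\Delta$ ticks; in an asynchronous network every honest party makes infinitely many steps and every message arrives eventually. A protocol is a $(t_s,t_a)$-secure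 Byzantine agreement protocol solving $V$ if the following hold against every such adversary, with up to $t_s$ corrupted parties when the network is synchronous and with up to $t_a$ corrupted parties when it is asynchronous, for every configuration $I$ of the honest inputs: - (probabilistic termination) for every honest party, the probability that it has not decided by time $t$ tends to $0$ as $t\to\infty$; - (agreement) almost surely, no two honest parties decide different values; - (validity) almost surely, no honest party decides a value outside $V(I)$. Claim. If there is a $(t_s,t_a)$-secure Byzantine agreement protocol, without cryptographic setup, that solves $V$, then $V$ is trivial. -/

import Mathlib

open MeasureTheory Filter Topology

namespace NetworkAgnostic

universe u v w

/-- An input configuration: `val i = some x` means that party `i` is honest with input `x`, and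
`val i = none` means that party `i` is corrupted. At least `n - ts` parties are honest. -/
structure InputConfig (n ts : ℕ) (Vin : Type v) where
  val : Fin n → Option Vin
  card_honest : n ≤ (Finset.univ.filter fun i => (val i).isSome).card + ts

/-- A validity property maps every input configuration to its set of valid outputs. -/
abbrev ValidityProperty (n ts : ℕ) (Vin : Type v) (Vout : Type w) :=
  InputConfig n ts Vin → Set Vout

/-- Some output is valid for all input configurations. -/
def ValidityProperty.IsTrivial {n ts : ℕ} {Vin : Type v} {Vout : Type w}
    (V : ValidityProperty n ts Vin Vout) : Prop :=
  (⋂ I : InputConfig n ts Vin, V I).Nonempty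

/-- What a party receives in one of its steps: for every sender, the multiset of messages that
arrive. The receiver knows the sender (authenticated channels). -/
abbrev Inbox (n : ℕ) (M : Type u) := Fin n → Multiset M

/-- The messages sent at one tick: `m j i` is what `j` sends to `i`, if anything. -/
abbrev Traffic (n : ℕ) (M : Type u) := Fin n → Fin n → Option M

/-- A randomized protocol for `n` parties without cryptographic setup.

Messages range over a countable set. The randomness consists of a public random string, which
everybody (the adversary too) knows, and of private random strings of the parties, which are
independent of each other and of the public one; there is no correlated secret randomness.

A party is a deterministic function of its input, the randomness it knows, and the list of
inboxes it has received in its steps so far (the length of this list is its local clock):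
`send` gives the messages that it sends in its latest step, and `output` its decision, if it
has decided by then. -/
structure Protocol (n : ℕ) (Vin : Type v) (Vout : Type w) where
  Msg : Type u
  [msgCountable : Countable Msg]
  Pub : Type u
  [pubMeasurableSpace : MeasurableSpace Pub]
  pubLaw : Measure Pub
  [pubProb : IsProbabilityMeasure pubLaw]
  Priv : Fin n → Type u
  [privMeasurableSpace : ∀ i, MeasurableSpace (Priv i)]
  privLaw : ∀ i, Measure (Priv i)
  [privProb : ∀ i, IsProbabilityMeasure (privLaw i)]
  send : ∀ i, Vin → Pub → Priv i → List (Inbox n Msg) → Fin n → Option Msg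
  output : ∀ i, Vin → Pub → Priv i → List (Inbox n Msg) → Option Vout
  measurableSet_send : ∀ i x h j m,
    MeasurableSet {r : Pub × Priv i | send i x r.1 r.2 h j = m}
  measurableSet_undecided : ∀ i x h,
    MeasurableSet {r : Pub × Priv i | output i x r.1 r.2 h = none}
  /-- Decisions are irrevocable. -/
  output_append : ∀ i x p r h b y,
    output i x p r h = some y → output i x p r (h ++ [b]) = some y

attribute [instance] Protocol.msgCountable Protocol.pubMeasurableSpace Protocol.pubProb
  Protocol.privMeasurableSpace Protocol.privProb

variable {n ts : ℕ} {Vin : Type v} {Vout : Type w}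

/-- A static, computationally unbounded adversary. It controls the corrupted parties (those
without an input in the input configuration) and the schedule. Its knowledge is the public
randomness, its own coins, and, for every tick so far, the messages that honest parties sent to
corrupted parties.

At the beginning of a tick, knowing what it saw in earlier ticks, it chooses
* `active i`: whether party `i` makes a step at this tick;
* `deliver s j i`: whether the message sent at tick `s` by `j` to `i`, if it exists and is still
  in transit, is delivered if `i` makes a step now.

After it has also seen the messages of the current tick, it chooses
* `byz j i`: the message that the corrupted party `j` sends to `i` at this tick. -/
structure Adversary (P : Protocol.{u} n Vin Vout) where
  Coin : Type u
  [coinMeasurableSpace : MeasurableSpace Coin]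
  coinLaw : Measure Coin
  [coinProb : IsProbabilityMeasure coinLaw]
  active : P.Pub → Coin → List (Traffic n P.Msg) → Fin n → Prop
  deliver : P.Pub → Coin → List (Traffic n P.Msg) → ℕ → Fin n → Fin n → Prop
  byz : P.Pub → Coin → List (Traffic n P.Msg) → Traffic n P.Msg
  measurableSet_active : ∀ h i, MeasurableSet {r : P.Pub × Coin | active r.1 r.2 h i}
  measurableSet_deliver : ∀ h s j i, MeasurableSet {r : P.Pub × Coin | deliver r.1 r.2 h s j i}
  measurableSet_byz : ∀ h j i m, MeasurableSet {r : P.Pub × Coin | byz r.1 r.2 h j i = m}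

attribute [instance] Adversary.coinMeasurableSpace Adversary.coinProb

/-- The global state between two ticks. -/
structure GlobalState (n : ℕ) (M : Type u) where
  /-- The inboxes that each party has received in its steps so far. -/
  hist : Fin n → List (Inbox n M)
  /-- `transit s j i` is the message sent at tick `s` by `j` to `i`, until it is delivered. -/
  transit : ℕ → Traffic n M
  /-- What the adversary has seen, tick by tick. -/
  seen : List (Traffic n M)

namespace Adversary

variable {P : Protocol.{u} n Vin Vout} (A : Adversary P) (I : InputConfig n ts Vin)

/-- The randomness of an execution: public, private, and that of the adversary. -/
abbrev Sample : Type u := P.Pub × (∀ i, P.Priv i) × A.Coin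

/-- The three kinds of randomness, and the private random strings, are independent. -/
noncomputable def law : Measure A.Sample :=
  P.pubLaw.prod ((Measure.pi P.privLaw).prod A.coinLaw)

open Classical in
/-- The transition from the global state `g` before tick `t` to the one after it. -/
noncomputable def tick (ω : A.Sample) (t : ℕ) (g : GlobalState n P.Msg) :
    GlobalState n P.Msg :=
  let act : Fin n → Prop := A.active ω.1 ω.2.2 g.seen
  let del : ℕ → Fin n → Fin n → Prop := A.deliver ω.1 ω.2.2 g.seen
  let inbox : Fin n → Inbox n P.Msg := fun i j =>
    ∑ s ∈ Finset.range t, if del s j i then (g.transit s j i).elim 0 (fun m => {m}) else 0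
  let hist : Fin n → List (Inbox n P.Msg) := fun i =>
    if act i then g.hist i ++ [inbox i] else g.hist i
  let honest : Traffic n P.Msg := fun j i =>
    match I.val j with
    | some x => if act j then P.send j x ω.1 (ω.2.1 j) (hist j) i else none
    | none => none
  let seen : List (Traffic n P.Msg) :=
    g.seen ++ [fun j i => if (I.val i).isNone then honest j i else none]
  let sent : Traffic n P.Msg := fun j i =>
    if (I.val j).isSome then honest j i else A.byz ω.1 ω.2.2 seen j i
  { hist := hist
    transit := fun s j i =>
      if s = t then sent j i
      else if act i ∧ del s j i then none
      else g.transit s j i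
    seen := seen }

/-- The execution: `run I ω t` is the global state just before tick `t`. -/
noncomputable def run (ω : A.Sample) : ℕ → GlobalState n P.Msg
  | 0 => { hist := fun _ => [], transit := fun _ _ _ => none, seen := [] }
  | t + 1 => A.tick I ω t (run ω t)

/-- Party `i` makes a step at tick `t`. -/
def ActiveAt (ω : A.Sample) (t : ℕ) (i : Fin n) : Prop :=
  A.active ω.1 ω.2.2 (A.run I ω t).seen i

/-- At tick `t`, party `i` makes a step and whatever is still in transit to it from `j` since
tick `s` is delivered. -/
def DeliveredAt (ω : A.Sample) (t s : ℕ) (j i : Fin n) : Prop :=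
  A.ActiveAt I ω t i ∧ A.deliver ω.1 ω.2.2 (A.run I ω t).seen s j i

/-- The decision (if any) before tick `t` of a party `i` that runs the protocol on input `x`. -/
noncomputable def outputAt (ω : A.Sample) (t : ℕ) (i : Fin n) (x : Vin) : Option Vout :=
  P.output i x ω.1 (ω.2.1 i) ((A.run I ω t).hist i)

/-- The network is synchronous: every honest party makes a step at every tick (so that local
clocks are perfectly synchronized), and messages arrive within `Δ` ticks. -/
def IsSynchronous (Δ : ℕ) : Prop :=
  ∀ ω : A.Sample, ∀ i, (I.val i).isSome →
    (∀ t, A.ActiveAt I ω t i) ∧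
    ∀ s j, ∃ t, s < t ∧ t ≤ s + Δ ∧ A.DeliveredAt I ω t s j i

/-- The network is asynchronous: every honest party makes infinitely many steps, and messages
arrive eventually. -/
def IsAsynchronous : Prop :=
  ∀ ω : A.Sample, ∀ i, (I.val i).isSome →
    (∀ t₀, ∃ t, t₀ ≤ t ∧ A.ActiveAt I ω t i) ∧
    ∀ s j, ∃ t, s < t ∧ A.DeliveredAt I ω t s j i

/-- Probabilistic termination, agreement and validity of the execution with input configuration
`I` and adversary `A`. -/
structure Achieves (V : ValidityProperty n ts Vin Vout) : Prop where
  termination : ∀ i x, I.val i = some x →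
    Tendsto (fun t => A.law {ω | A.outputAt I ω t i x = none}) atTop (𝓝 0)
  agreement : ∀ᵐ ω ∂A.law, ∀ i x j x' t t' y y', I.val i = some x → I.val j = some x' →
    A.outputAt I ω t i x = some y → A.outputAt I ω t' j x' = some y' → y = y'
  validity : ∀ᵐ ω ∂A.law, ∀ i x t y, I.val i = some x →
    A.outputAt I ω t i x = some y → y ∈ V I

end Adversary

/-- `P` is a `(ts, ta)`-secure Byzantine agreement protocol solving `V` (in the network-agnostic
model with delay bound `Δ`): it achieves probabilistic termination, agreement and validity
with up to `ts` corruptions if the network is synchronous, and with up to `ta` corruptions if it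
is asynchronous. (An input configuration has at most `ts` corrupted parties by definition.) -/
structure Protocol.IsSecure (P : Protocol.{u} n Vin Vout) (Δ ta : ℕ)
    (V : ValidityProperty n ts Vin Vout) : Prop where
  synchronous : ∀ (I : InputConfig n ts Vin) (A : Adversary P),
    A.IsSynchronous I Δ → A.Achieves I V
  asynchronous : ∀ (I : InputConfig n ts Vin) (A : Adversary P),
    (Finset.univ.filter fun i => (I.val i).isNone).card ≤ ta →
    A.IsAsynchronous I → A.Achieves I V

end NetworkAgnostic

/-! Let `n ≥ 3`; here synchronous security suffices. Split the parties into three groups of at most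
`ts` and join many copies of the network into a ring of groups. Without secret setup, corrupted
parties can sample fresh private strings and simulate any part of the ring; so two adjacent groups
cannot tell the ring from a real execution in which the third group is corrupted
(`Protocol.IsSecure.ae_coverSecure`). Adjacent groups therefore agree, and the whole ring decides
one value (`Protocol.IsSecure.ae_ring_agreement`).

Give one half of the ring the inputs `x` and the other half `x'`. Messages are countable, so a
typical transcript up to time `T` has positive probability. Hence, for almost all private strings
`r` and `r'`, all copies in the first half may be assumed to produce the transcript of `(x, r)` and
all those in the second half that of `(x', r')` (`ae_exists_resample`). Influence moves one copy per
step, so the middle copies of the halves behave until `T` as in executions where everybody is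
honest. Given the public string, the honest decision thus depends neither on inputs nor on private
strings (`Protocol.IsSecure.ae_fullOutput_agreement`). It is valid for every configuration, since
corrupted parties may follow the protocol.

For `n = 2` asynchrony is used. A party facing a silent corrupted peer must decide alone. If both
are honest and their messages are delayed past these decisions, the decisions must agree. Changing
one input at a time shows that the common value is independent of the inputs. -/

namespace NetworkAgnostic

universe u v w

/-! ### Measurability and null sets for countably valued maps. -/

section Fibers

variable {Ω S S' : Type*} [MeasurableSpace Ω]

/-- All fibers of `f` are measurable. -/
def MeasurableFibers (f : Ω → S) : Prop :=
  ∀ s, MeasurableSet {ω | f ω = s}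

namespace MeasurableFibers

theorem const (s : S) : MeasurableFibers fun _ : Ω => s :=
  fun _ => MeasurableSet.const _

theorem preimage [Countable S] {f : Ω → S} (hf : MeasurableFibers f) (p : S → Prop) :
    MeasurableSet {ω | p (f ω)} := by
  have h : {ω | p (f ω)} = ⋃ s ∈ {s | p s}, {ω | f ω = s} := by
    ext ω; simp
  rw [h]
  exact MeasurableSet.biUnion (Set.to_countable _) fun s _ => hf s

theorem comp [Countable S] {f : Ω → S} (hf : MeasurableFibers f) (g : S → S') :
    MeasurableFibers fun ω => g (f ω) :=
  fun s => hf.preimage fun a => g a = s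

theorem bind [Countable S] {f : Ω → S} (hf : MeasurableFibers f) {g : Ω → S → S'}
    (hg : ∀ a, MeasurableFibers fun ω => g ω a) : MeasurableFibers fun ω => g ω (f ω) := by
  intro s
  have h : {ω | g ω (f ω) = s} = ⋃ a, {ω | f ω = a} ∩ {ω | g ω a = s} := by
    ext ω; simp
  rw [h]
  exact MeasurableSet.iUnion fun a => (hf a).inter (hg a s)

theorem pi {ι : Type*} [Countable ι] {f : Ω → ι → S} (hf : ∀ i, MeasurableFibers fun ω => f ω i) :
    MeasurableFibers f := by
  intro s
  have h : {ω | f ω = s} = ⋂ i, {ω | f ω i = s i} := by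
    ext ω; simp [funext_iff]
  rw [h]
  exact MeasurableSet.iInter fun i => hf i (s i)

end MeasurableFibers

/-- There are only countably many null fibers, so their union is null. This makes the transcript of
a typical sample recur with positive probability. -/
theorem ae_measure_fiber_ne_zero [Countable S] (f : Ω → S) (μ : Measure Ω) :
    ∀ᵐ ω ∂μ, μ {ω' | f ω' = f ω} ≠ 0 := by
  have h : {ω | ¬ μ {ω' | f ω' = f ω} ≠ 0} ⊆ ⋃ s ∈ {s | μ {ω' | f ω' = s} = 0}, {ω | f ω = s} := by
    intro ω hω
    simpa using hω
  refine measure_mono_null h ?_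
  rw [measure_biUnion_null_iff (Set.to_countable _)]
  exact fun s hs => hs

end Fibers

/-! ### Lock-step executions on covers of the network. -/

section Cover

variable {n : ℕ} {Vin : Type v} {Vout : Type w} (P : Protocol.{u} n Vin Vout) {K : Type*}

/-- What `i` gets from `j` if the latest step of `j` led to the history `h`. -/
noncomputable def Protocol.delivery (j : Fin n) (x : Vin) (p : P.Pub) (r : P.Priv j)
    (h : List (Inbox n P.Msg)) (i : Fin n) : Multiset P.Msg :=
  open Classical in if h = [] then 0 else (P.send j x p r h i).elim 0 fun m => {m}

theorem Protocol.measurableFibers_send {Ω : Type*} [MeasurableSpace Ω] (j : Fin n) (x : Vin)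
    {p : Ω → P.Pub} {r : Ω → P.Priv j} (hp : Measurable p) (hr : Measurable r)
    {h : Ω → List (Inbox n P.Msg)} (hh : MeasurableFibers h) (i : Fin n) :
    MeasurableFibers fun ω => P.send j x (p ω) (r ω) (h ω) i :=
  hh.bind fun a m => (hp.prodMk hr) (P.measurableSet_send j x a i m)

theorem Protocol.measurableFibers_delivery {Ω : Type*} [MeasurableSpace Ω] (j : Fin n) (x : Vin)
    {p : Ω → P.Pub} {r : Ω → P.Priv j} (hp : Measurable p) (hr : Measurable r)
    {h : Ω → List (Inbox n P.Msg)} (hh : MeasurableFibers h) (i : Fin n) :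
    MeasurableFibers fun ω => P.delivery j x (p ω) (r ω) (h ω) i := by
  classical
  refine hh.bind (g := fun ω a => P.delivery j x (p ω) (r ω) a i) fun a => ?_
  unfold Protocol.delivery
  by_cases ha : a = []
  · simp only [if_pos ha]
    exact .const _
  · simp only [if_neg ha]
    exact (P.measurableFibers_send j x hp hr (.const a) i).comp
      fun o => Option.elim o (0 : Multiset P.Msg) fun m => {m}

/-- The lock-step execution on a cover of the communication network: there are several copies
of every party, `nb k i j` is the copy of `j` (if any) with which the copy `k` of `i` is
connected, `x k i` is its input and `ω k i` its private random string. `P.covHist nb x p ω t k i`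
is its history after its first `t` steps. -/
noncomputable def Protocol.covHist (nb : K → Fin n → Fin n → Option K) (x : K → Fin n → Vin)
    (p : P.Pub) (ω : K → ∀ i, P.Priv i) : ℕ → K → Fin n → List (Inbox n P.Msg)
  | 0 => fun _ _ => []
  | t + 1 => fun k i => Protocol.covHist nb x p ω t k i ++ [fun j => (nb k i j).elim 0 fun k' =>
      P.delivery j (x k' j) p (ω k' j) (Protocol.covHist nb x p ω t k' j) i]

/-- The decision of a copy of a party in the lock-step execution on a cover. -/
noncomputable def Protocol.covOutput (nb : K → Fin n → Fin n → Option K) (x : K → Fin n → Vin)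
    (p : P.Pub) (ω : K → ∀ i, P.Priv i) (t : ℕ) (k : K) (i : Fin n) : Option Vout :=
  P.output i (x k i) p (ω k i) (P.covHist nb x p ω t k i)

variable {P}

theorem Protocol.length_covHist (nb : K → Fin n → Fin n → Option K) (x : K → Fin n → Vin)
    (p : P.Pub) (ω : K → ∀ i, P.Priv i) (t : ℕ) (k : K) (i : Fin n) :
    (P.covHist nb x p ω t k i).length = t := by
  induction t generalizing k i with
  | zero => rfl
  | succ t ih => simp [Protocol.covHist, ih]

theorem Protocol.covOutput_mono {nb : K → Fin n → Fin n → Option K} {x : K → Fin n → Vin}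
    {p : P.Pub} {ω : K → ∀ i, P.Priv i} {t t' : ℕ} (htt : t ≤ t') {k : K} {i : Fin n} {y : Vout}
    (h : P.covOutput nb x p ω t k i = some y) : P.covOutput nb x p ω t' k i = some y := by
  induction t', htt using Nat.le_induction with
  | base => exact h
  | succ t' _ ih => exact P.output_append _ _ _ _ _ _ _ ih

end Cover

/-! ### Simulating a cover by corrupted parties. -/

section Simulation

variable {n : ℕ} {Vin : Type v} {Vout : Type w} {P : Protocol.{u} n Vin Vout} {K : Type}

/-- The histories of the copies that the adversary simulates: the real parties are the copies
`kap i` of `i`, and what they send is read off from what the adversary has seen. -/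
noncomputable def simHist (nb : K → Fin n → Fin n → Option K) (x : K → Fin n → Vin)
    (kap : Fin n → K) (p : P.Pub) (c : ∀ w : {w : K × Fin n // w.1 ≠ kap w.2}, P.Priv w.1.2)
    (seen : List (Traffic n P.Msg)) : ℕ → K → Fin n → List (Inbox n P.Msg)
  | 0 => fun _ _ => []
  | t + 1 => fun k i => simHist nb x kap p c seen t k i ++ [fun j => (nb k i j).elim 0 fun k' =>
      open Classical in
      if h : k' ≠ kap j then
        P.delivery j (x k' j) p (c ⟨(k', j), h⟩) (simHist nb x kap p c seen t k' j) i
      -- The message delivered at step `t + 1` comes from the sender's history of length `t`,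
      -- reached at tick `t - 1`; nothing arrives at the first step.
      else if t = 0 then 0
      else (seen.getD (t - 1) (fun _ _ => none) j i).elim 0 fun m => {m}]

/-- What the adversary lets the corrupted party `j` send to `i`. -/
noncomputable def simByz (nb : K → Fin n → Fin n → Option K) (x : K → Fin n → Vin)
    (kap : Fin n → K) (p : P.Pub) (c : ∀ w : {w : K × Fin n // w.1 ≠ kap w.2}, P.Priv w.1.2)
    (seen : List (Traffic n P.Msg)) : Traffic n P.Msg := fun j i =>
  (nb (kap i) i j).elim none fun k' =>
    open Classical in
    if h : k' ≠ kap j then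
      P.send j (x k' j) p (c ⟨(k', j), h⟩) (simHist nb x kap p c seen seen.length k' j) i
    else none

theorem measurableFibers_simHist (nb : K → Fin n → Fin n → Option K) (x : K → Fin n → Vin)
    (kap : Fin n → K) (seen : List (Traffic n P.Msg)) (t : ℕ) (k : K) (i : Fin n) :
    MeasurableFibers fun z : P.Pub × (∀ w : {w : K × Fin n // w.1 ≠ kap w.2}, P.Priv w.1.2) =>
      simHist nb x kap z.1 z.2 seen t k i := by
  induction t generalizing k i with
  | zero => exact .const _
  | succ t ih =>
    refine (ih k i).bind (g := fun z a => a ++ [fun j => (nb k i j).elim 0 fun k' =>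
      open Classical in
      if h : k' ≠ kap j then
        P.delivery j (x k' j) z.1 (z.2 ⟨(k', j), h⟩) (simHist nb x kap z.1 z.2 seen t k' j) i
      else if t = 0 then 0
      else (seen.getD (t - 1) (fun _ _ => none) j i).elim 0 fun m => {m}]) fun a => ?_
    refine MeasurableFibers.comp (S := Inbox n P.Msg) ?_ fun b => a ++ [b]
    refine .pi fun j => ?_
    cases hk : nb k i j with
    | none => exact .const _
    | some k' =>
      by_cases h : k' ≠ kap j
      · simp only [Option.elim_some, dif_pos h]
        exact P.measurableFibers_delivery j _ measurable_fst
          ((measurable_pi_apply (⟨(k', j), h⟩ : {w : K × Fin n // w.1 ≠ kap w.2})).comp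
            measurable_snd) (ih k' j) i
      · simp only [Option.elim_some, dif_neg h]
        exact .const _

theorem measurableFibers_simByz (nb : K → Fin n → Fin n → Option K) (x : K → Fin n → Vin)
    (kap : Fin n → K) (seen : List (Traffic n P.Msg)) (j i : Fin n) :
    MeasurableFibers fun z : P.Pub × (∀ w : {w : K × Fin n // w.1 ≠ kap w.2}, P.Priv w.1.2) =>
      simByz nb x kap z.1 z.2 seen j i := by
  unfold simByz
  cases hk : nb (kap i) i j with
  | none => exact .const _
  | some k' =>
    by_cases h : k' ≠ kap j
    · simp only [Option.elim_some, dif_pos h]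
      exact P.measurableFibers_send j _ measurable_fst
        ((measurable_pi_apply (⟨(k', j), h⟩ : {w : K × Fin n // w.1 ≠ kap w.2})).comp
          measurable_snd) (measurableFibers_simHist nb x kap seen _ k' j) i
    · simp only [Option.elim_some, dif_neg h]
      exact .const _

/-- The adversary that makes the network run in lock-step and simulates all copies but the
copies `kap i` of `i`. -/
noncomputable def simAdversary (P : Protocol.{u} n Vin Vout) [Fintype K]
    (nb : K → Fin n → Fin n → Option K) (x : K → Fin n → Vin) (kap : Fin n → K) :
    Adversary P where
  Coin := ∀ w : {w : K × Fin n // w.1 ≠ kap w.2}, P.Priv w.1.2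
  coinLaw := open Classical in Measure.pi fun w => P.privLaw w.1.2
  active _ _ _ _ := True
  deliver _ _ _ _ _ _ := True
  byz := simByz nb x kap
  measurableSet_active _ _ := MeasurableSet.univ
  measurableSet_deliver _ _ _ _ := MeasurableSet.univ
  measurableSet_byz h j i := measurableFibers_simByz nb x kap h j i

theorem simAdversary_isSynchronous [Fintype K] {ts Δ : ℕ} (hΔ : 0 < Δ)
    (nb : K → Fin n → Fin n → Option K) (x : K → Fin n → Vin) (kap : Fin n → K)
    (I : InputConfig n ts Vin) : (simAdversary P nb x kap).IsSynchronous I Δ :=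
  fun _ _ _ => ⟨fun _ => trivial, fun s _ => ⟨s + 1, by lia, by lia, trivial, trivial⟩⟩

/-- The adversary holds the strings of the copies it simulates and sees all that honest parties send
to corrupted ones. No simulated copy needs a message between two honest parties, because honest
parties are linked to each other's real copies. Messages into step `T` were sent at tick `T - 2` or
earlier, hence the bound `s + 2 ≤ T`. -/
theorem simHist_eq_covHist {nb : K → Fin n → Fin n → Option K} {x : K → Fin n → Vin}
    {kap : Fin n → K} {hon : Fin n → Prop}
    (hsymm : ∀ k i j k', nb k i j = some k' → nb k' j i = some k)
    (hhon : ∀ i j, hon i → hon j → nb (kap i) i j = some (kap j))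
    (hcor : ∀ k i j, ¬ hon j → nb k i j ≠ some (kap j))
    {p : P.Pub} {ω : K → ∀ i, P.Priv i} {seen : List (Traffic n P.Msg)} {T : ℕ}
    (hseen : ∀ s, s + 2 ≤ T → ∀ j i, hon j → ¬ hon i →
      seen.getD s (fun _ _ => none) j i =
        P.send j (x (kap j) j) p (ω (kap j) j) (P.covHist nb x p ω (s + 1) (kap j) j) i)
    (t : ℕ) (ht : t ≤ T) (k : K) (i : Fin n) (hk : hon i → k ≠ kap i) :
    simHist nb x kap p (fun w => ω w.1.1 w.1.2) seen t k i = P.covHist nb x p ω t k i := by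
  induction t generalizing k i with
  | zero => rfl
  | succ t ih =>
    simp only [simHist, Protocol.covHist]
    rw [ih (by lia) k i hk]
    congr 2
    funext j
    cases hnb : nb k i j with
    | none => rfl
    | some k' =>
      simp only [Option.elim_some]
      by_cases h : k' ≠ kap j
      · rw [dif_pos h, ih (by lia) k' j fun _ => h]
      · rw [dif_neg h]
        obtain rfl : k' = kap j := not_not.1 h
        have hj : hon j := by
          by_contra hj
          exact hcor k i j hj hnb
        -- Were `i` honest, the link back from the real copy of `j` would end at the real copy of
        -- `i`, which is excluded. So the message goes to a corrupted party and is seen.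
        have hi : ¬ hon i := by
          intro hi
          have h1 := hsymm _ _ _ _ hnb
          rw [hhon j i hj hi] at h1
          exact hk hi (Option.some.inj h1).symm
        cases t with
        | zero => simp [Protocol.delivery, Protocol.covHist]
        | succ s =>
          have hne : P.covHist nb x p ω (s + 1) (kap j) j ≠ [] := by
            simp [Protocol.covHist]
          rw [if_neg (by lia), Protocol.delivery, if_neg hne, Nat.add_sub_cancel,
            hseen s (by lia) j i hj hi]

/-- The real execution against `simAdversary` is a part of the execution on the cover. -/
theorem run_simAdversary [Fintype K] {ts : ℕ} {nb : K → Fin n → Fin n → Option K}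
    {x : K → Fin n → Vin} {kap : Fin n → K} {I : InputConfig n ts Vin}
    (hI : ∀ i, (I.val i).isSome → I.val i = some (x (kap i) i))
    (hsymm : ∀ k i j k', nb k i j = some k' → nb k' j i = some k)
    (hhon : ∀ i j, (I.val i).isSome → (I.val j).isSome → nb (kap i) i j = some (kap j))
    (hcor : ∀ k i j, ¬ (I.val j).isSome → nb k i j ≠ some (kap j))
    (p : P.Pub) (ω : K → ∀ i, P.Priv i) (t : ℕ) :
    let g := (simAdversary P nb x kap).run I (p, fun i => ω (kap i) i, fun w => ω w.1.1 w.1.2) t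
    (∀ i, (I.val i).isSome → g.hist i = P.covHist nb x p ω t (kap i) i) ∧
    g.seen.length = t ∧
    (∀ s, s < t → ∀ j i, (I.val j).isSome → ¬ (I.val i).isSome →
      g.seen.getD s (fun _ _ => none) j i =
        P.send j (x (kap j) j) p (ω (kap j) j) (P.covHist nb x p ω (s + 1) (kap j) j) i) ∧
    (∀ s j i, (I.val i).isSome → g.transit s j i = if s + 1 = t then
      (nb (kap i) i j).elim none fun k' =>
        P.send j (x k' j) p (ω k' j) (P.covHist nb x p ω t k' j) i else none) := by
  classical
  induction t with
  | zero => simp [Adversary.run, Protocol.covHist]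
  | succ t ih =>
    intro g
    set g₀ := (simAdversary P nb x kap).run I
      (p, fun i => ω (kap i) i, fun w => ω w.1.1 w.1.2) t with hg₀
    obtain ⟨ih1, ih2, ih3, ih4⟩ := ih
    have hg : g = (simAdversary P nb x kap).tick I
      (p, fun i => ω (kap i) i, fun w => ω w.1.1 w.1.2) t g₀ := rfl
    have hhist : ∀ i, (I.val i).isSome →
        g.hist i = P.covHist nb x p ω (t + 1) (kap i) i := by
      intro i hi
      have h : g.hist i = g₀.hist i ++ [fun j => ∑ s ∈ Finset.range t,
          (g₀.transit s j i).elim 0 fun m => {m}] := by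
        refine (if_pos trivial).trans ?_
        congr 2
        funext j
        exact Finset.sum_congr rfl fun s _ => if_pos trivial
      rw [h, ih1 i hi, Protocol.covHist]
      congr 2
      funext j
      simp only [ih4 _ j i hi]
      cases t with
      | zero => cases hnb : nb (kap i) i j <;> simp [Protocol.delivery, Protocol.covHist]
      | succ t =>
        -- In lock-step only messages of the preceding tick are still in transit, so only the last
        -- summand survives.
        rw [Finset.sum_range_succ, Finset.sum_eq_zero, zero_add, if_pos rfl]
        · cases hnb : nb (kap i) i j with
          | none => rfl
          | some k' =>
            have hne : P.covHist nb x p ω (t + 1) k' j ≠ [] := by simp [Protocol.covHist]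
            simp only [Option.elim_some, Protocol.delivery, if_neg hne]
        · intro s hs
          have := Finset.mem_range.1 hs
          rw [if_neg (by lia)]
          rfl
    have hsend : ∀ j, (I.val j).isSome → ∀ y, I.val j = some y → ∀ i,
        P.send j y p (ω (kap j) j) (g.hist j) i =
          P.send j (x (kap j) j) p (ω (kap j) j) (P.covHist nb x p ω (t + 1) (kap j) j) i := by
      intro j hj y hy i
      rw [hI j hj] at hy
      rw [hhist j hj, Option.some.inj hy]
    have hlen : g.seen.length = t + 1 := by
      simp [hg, Adversary.tick, ih2]
    have hseen : ∀ s, s < t + 1 → ∀ j i, (I.val j).isSome → ¬ (I.val i).isSome →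
        g.seen.getD s (fun _ _ => none) j i =
          P.send j (x (kap j) j) p (ω (kap j) j)
            (P.covHist nb x p ω (s + 1) (kap j) j) i := by
      intro s hs j i hj hi
      rcases Nat.lt_succ_iff_lt_or_eq.1 hs with hs | rfl
      · rw [← ih3 s hs j i hj hi]
        have : g.seen.getD s (fun _ _ => none) = g₀.seen.getD s (fun _ _ => none) := by
          rw [hg]
          simp only [Adversary.tick]
          rw [List.getD_append _ _ _ _ (by lia)]
        rw [this]
      · rw [← hsend j hj _ (hI j hj) i]
        have hi' : I.val i = none := by simpa using hi
        conv_lhs => rw [hg]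
        simp only [Adversary.tick]
        rw [List.getD_append_right _ _ _ _ (by lia), ih2, Nat.sub_self, List.getD_cons_zero]
        simp only [hi', Option.isNone_none, if_true, hI j hj]
        exact if_pos trivial
    refine ⟨hhist, hlen, hseen, fun s j i hi => ?_⟩
    by_cases hs : s = t
    · subst hs
      rw [if_pos rfl]
      by_cases hj : (I.val j).isSome
      · rw [hhon i j hi hj, Option.elim_some, ← hsend j hj _ (hI j hj) i, hg]
        simp only [Adversary.tick, hI j hj, Option.isSome_some, if_true]
        exact (if_pos trivial).trans rfl
      · have : g.transit s j i =
            simByz nb x kap p (fun w => ω w.1.1 w.1.2) g.seen j i := by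
          simp only [hg, Adversary.tick, if_true, if_neg hj]
          rfl
        rw [this, simByz]
        cases hnb : nb (kap i) i j with
        | none => rfl
        | some k' =>
          have hk' : k' ≠ kap j := by
            rintro rfl
            exact hcor _ _ _ hj hnb
          simp only [Option.elim_some, dif_pos hk', hlen]
          rw [simHist_eq_covHist hsymm hhon hcor (T := s + 1)
            (fun s' hs' j i hj hi => hseen s' (by lia) j i hj hi) (s + 1) le_rfl k' j
            fun h => absurd h hj]
    · rw [if_neg (by lia)]
      simp [hg, Adversary.tick, simAdversary, hs]

end Simulation

/-! ### Splitting independent strings into real ones and coins of the adversary. -/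

section Measure

variable {ι K : Type*} [Fintype ι] [Fintype K] {X : ι → Type*} [∀ i, MeasurableSpace (X i)]
  (μ : ∀ i, Measure (X i)) [∀ i, IsProbabilityMeasure (μ i)]

theorem measurePreserving_uncurry :
    MeasurePreserving (fun (ω : K → ∀ i, X i) (w : K × ι) => ω w.1 w.2)
      (Measure.pi fun _ => Measure.pi μ) (Measure.pi fun w : K × ι => μ w.2) := by
  have hm : Measurable fun (ω : K → ∀ i, X i) (w : K × ι) => ω w.1 w.2 :=
    measurable_pi_lambda _ fun w => (measurable_pi_apply w.2).comp (measurable_pi_apply w.1)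
  refine ⟨hm, (Measure.pi_eq fun s hs => ?_).symm⟩
  rw [Measure.map_apply hm (.univ_pi hs)]
  have h : (fun (ω : K → ∀ i, X i) (w : K × ι) => ω w.1 w.2) ⁻¹' Set.univ.pi s =
      Set.univ.pi fun k => Set.univ.pi fun i => s (k, i) := by
    ext ω; simp
  rw [h, Measure.pi_pi, Fintype.prod_prod_type]
  simp_rw [Measure.pi_pi]

-- The pairs `(kap i, i)` and the remaining pairs partition `K × ι`. The first carry the strings of
-- the real parties, the others the coins of `simAdversary`, so the cover and the real execution
-- live on the same probability space.
open Classical in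
theorem measurePreserving_split (kap : ι → K) :
    MeasurePreserving (fun ω : K → ∀ i, X i => ((fun i => ω (kap i) i),
        (fun w : {w : K × ι // w.1 ≠ kap w.2} => ω w.1.1 w.1.2)))
      (Measure.pi fun _ => Measure.pi μ)
      ((Measure.pi μ).prod (Measure.pi fun w : {w : K × ι // w.1 ≠ kap w.2} => μ w.1.2)) := by
  let f : ι ⊕ {w : K × ι // w.1 ≠ kap w.2} → K × ι := Sum.elim (fun i => (kap i, i)) (fun w => w.1)
  have hf : Function.Bijective f := by
    constructor
    · rintro (i | ⟨w, hw⟩) (j | ⟨w', hw'⟩) h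
      · exact congrArg Sum.inl (Prod.ext_iff.1 h).2
      · obtain rfl : (kap i, i) = w' := h
        exact absurd rfl hw'
      · obtain rfl : w = (kap j, j) := h
        exact absurd rfl hw
      · exact congrArg Sum.inr (Subtype.ext h)
    · rintro ⟨k, i⟩
      by_cases h : k = kap i
      · exact ⟨Sum.inl i, by rw [h]; rfl⟩
      · exact ⟨Sum.inr ⟨(k, i), h⟩, rfl⟩
  have h1 := (measurePreserving_piCongrLeft (fun w : K × ι => μ w.2)
    (Equiv.ofBijective f hf)).symm
  have h2 := measurePreserving_sumPiEquivProdPi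
    (X := fun s => X (Equiv.ofBijective f hf s).2) (fun s => μ (Equiv.ofBijective f hf s).2)
  exact (h2.comp h1).comp (measurePreserving_uncurry μ)

end Measure

/-! ### Security transferred to covers. -/

section Secure

variable {n ts ta Δ : ℕ} {Vin : Type v} {Vout : Type w} {P : Protocol.{u} n Vin Vout} {K : Type}
  {V : ValidityProperty n ts Vin Vout}

/-- Never deciding implies being undecided at each time `t`, and these probabilities tend to `0`. -/
theorem Adversary.Achieves.ae_decides {A : Adversary P} {I : InputConfig n ts Vin}
    (h : A.Achieves I V) {i : Fin n} {x : Vin} (hi : I.val i = some x) :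
    ∀ᵐ ω ∂A.law, ∃ t y, A.outputAt I ω t i x = some y := by
  have h0 : A.law {ω | ∀ t, A.outputAt I ω t i x = none} ≤ 0 :=
    ge_of_tendsto (h.termination i x hi)
      (.of_forall fun t => measure_mono fun ω hω => hω t)
  have h1 : {ω | ¬ ∃ t y, A.outputAt I ω t i x = some y} ⊆
      {ω | ∀ t, A.outputAt I ω t i x = none} := by
    intro ω hω t
    by_contra hne
    obtain ⟨y, hy⟩ := Option.ne_none_iff_exists'.1 hne
    exact hω ⟨t, y, hy⟩
  exact measure_mono_null h1 (le_antisymm h0 zero_le)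

/-- What a secure protocol guarantees to the copies `kap i` of the parties `i` that are honest
in `I`, in the execution on a cover. -/
structure CoverSecure (P : Protocol.{u} n Vin Vout) (V : ValidityProperty n ts Vin Vout)
    (I : InputConfig n ts Vin) (nb : K → Fin n → Fin n → Option K) (x : K → Fin n → Vin)
    (kap : Fin n → K) (p : P.Pub) (ω : K → ∀ i, P.Priv i) : Prop where
  termination : ∀ i, (I.val i).isSome → ∃ t y, P.covOutput nb x p ω t (kap i) i = some y
  agreement : ∀ i j, (I.val i).isSome → (I.val j).isSome → ∀ t t' y y',
    P.covOutput nb x p ω t (kap i) i = some y → P.covOutput nb x p ω t' (kap j) j = some y' →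
    y = y'
  validity : ∀ i, (I.val i).isSome → ∀ t y, P.covOutput nb x p ω t (kap i) i = some y → y ∈ V I

/-- The real execution against `simAdversary` embeds into the cover. The string of `kap j` for a
corrupted `j` is the private string of a real party and not a coin, so the adversary could not
simulate that copy; `hcor` says that nobody hears from it. -/
theorem Protocol.IsSecure.ae_coverSecure_of_unheard [Fintype K] (hP : P.IsSecure Δ ta V)
    (hΔ : 0 < Δ) {nb : K → Fin n → Fin n → Option K}
    {x : K → Fin n → Vin} {kap : Fin n → K} {I : InputConfig n ts Vin}
    (hI : ∀ i, (I.val i).isSome → I.val i = some (x (kap i) i))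
    (hsymm : ∀ k i j k', nb k i j = some k' → nb k' j i = some k)
    (hhon : ∀ i j, (I.val i).isSome → (I.val j).isSome → nb (kap i) i j = some (kap j))
    (hcor : ∀ k i j, ¬ (I.val j).isSome → nb k i j ≠ some (kap j)) :
    ∀ᵐ z ∂P.pubLaw.prod (Measure.pi fun _ : K => Measure.pi P.privLaw),
      CoverSecure P V I nb x kap z.1 z.2 := by
  have hA := hP.synchronous I _ (simAdversary_isSynchronous (P := P) hΔ nb x kap I)
  have hmp : MeasurePreserving
      (fun z : P.Pub × (K → ∀ i, P.Priv i) => ((z.1, (fun i => z.2 (kap i) i),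
        fun w => z.2 w.1.1 w.1.2) : (simAdversary P nb x kap).Sample))
      (P.pubLaw.prod (Measure.pi fun _ : K => Measure.pi P.privLaw))
      (simAdversary P nb x kap).law :=
    (MeasurePreserving.id P.pubLaw).prod (measurePreserving_split P.privLaw kap)
  have hout : ∀ (z : P.Pub × (K → ∀ i, P.Priv i)) t i, (I.val i).isSome →
      (simAdversary P nb x kap).outputAt I (z.1, (fun i => z.2 (kap i) i),
        fun w => z.2 w.1.1 w.1.2) t i (x (kap i) i) = P.covOutput nb x z.1 z.2 t (kap i) i := by
    intro z t i hi
    rw [Adversary.outputAt, (run_simAdversary hI hsymm hhon hcor z.1 z.2 t).1 i hi]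
    rfl
  have hterm : ∀ᵐ ω ∂(simAdversary P nb x kap).law, ∀ i, (I.val i).isSome →
      ∃ t y, (simAdversary P nb x kap).outputAt I ω t i (x (kap i) i) = some y := by
    refine ae_all_iff.2 fun i => ?_
    by_cases hi : (I.val i).isSome
    · filter_upwards [hA.ae_decides (hI i hi)] with ω hω _ using hω
    · exact .of_forall fun ω h => absurd h hi
  filter_upwards [hmp.quasiMeasurePreserving.ae hterm,
    hmp.quasiMeasurePreserving.ae hA.agreement,
    hmp.quasiMeasurePreserving.ae hA.validity] with z h1 h2 h3
  constructor
  · intro i hi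
    simpa only [hout z _ i hi] using h1 i hi
  · intro i j hi hj t t' y y' hy hy'
    rw [← hout z t i hi] at hy
    rw [← hout z t' j hj] at hy'
    exact h2 i _ j _ t t' y y' (hI i hi) (hI j hj) hy hy'
  · intro i hi t y hy
    rw [← hout z t i hi] at hy
    exact h3 i _ t y (hI i hi) hy

/-- An isolated extra copy `none` of the network is added, and the corrupted parties are placed
there. Nobody hears from it, so all original copies become available to the simulation. -/
theorem Protocol.IsSecure.ae_coverSecure [Fintype K] (hP : P.IsSecure Δ ta V)
    (hΔ : 0 < Δ) {nb : K → Fin n → Fin n → Option K}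
    {x : K → Fin n → Vin} {kap : Fin n → K} {I : InputConfig n ts Vin}
    (hI : ∀ i, (I.val i).isSome → I.val i = some (x (kap i) i))
    (hsymm : ∀ k i j k', nb k i j = some k' → nb k' j i = some k)
    (hhon : ∀ i j, (I.val i).isSome → (I.val j).isSome → nb (kap i) i j = some (kap j)) :
    ∀ᵐ z ∂P.pubLaw.prod (Measure.pi fun _ : K => Measure.pi P.privLaw),
      CoverSecure P V I nb x kap z.1 z.2 := by
  let nb' : Option K → Fin n → Fin n → Option (Option K) :=
    fun o i j => o.elim none fun k => (nb k i j).map some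
  let x' : Option K → Fin n → Vin := fun o i => o.elim (x (kap i) i) fun k => x k i
  let kap' : Fin n → Option K := fun i => if (I.val i).isSome then some (kap i) else none
  have key := hP.ae_coverSecure_of_unheard hΔ (nb := nb') (x := x') (kap := kap') (I := I)
    (fun i hi => by simpa [kap', x', hi] using hI i hi)
    (by
      rintro (_ | k) i j k' h
      · exact absurd h (by simp [nb'])
      · obtain ⟨l, hl, rfl⟩ := Option.map_eq_some_iff.1 h
        simp [nb', hsymm _ _ _ _ hl])
    (fun i j hi hj => by simpa [nb', kap', hi, hj] using hhon i j hi hj)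
    (by
      rintro (_ | k) i j hj h
      · exact absurd h (by simp [nb'])
      · obtain ⟨l, hl, h⟩ := Option.map_eq_some_iff.1 h
        simp [kap', hj] at h)
  let F : (P.Pub × (K → ∀ i, P.Priv i)) × (∀ i, P.Priv i) → P.Pub × (Option K → ∀ i, P.Priv i) :=
    fun z => (z.1.1, fun o => o.elim z.2 z.1.2)
  have hF : MeasurePreserving F
      ((P.pubLaw.prod (Measure.pi fun _ : K => Measure.pi P.privLaw)).prod
        (Measure.pi P.privLaw))
      (P.pubLaw.prod (Measure.pi fun _ : Option K => Measure.pi P.privLaw)) := by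
    have hG : MeasurePreserving
        (fun (z : (K → ∀ i, P.Priv i) × (∀ i, P.Priv i)) (o : Option K) => o.elim z.2 z.1)
        ((Measure.pi fun _ : K => Measure.pi P.privLaw).prod (Measure.pi P.privLaw))
        (Measure.pi fun _ : Option K => Measure.pi P.privLaw) := by
      have hm : Measurable
          (fun (z : (K → ∀ i, P.Priv i) × (∀ i, P.Priv i)) (o : Option K) => o.elim z.2 z.1) := by
        refine measurable_pi_lambda _ ?_
        rintro (_ | k)
        · exact measurable_snd
        · exact (measurable_pi_apply k).comp measurable_fst
      refine ⟨hm, (Measure.pi_eq fun s hs => ?_).symm⟩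
      rw [Measure.map_apply hm (.univ_pi hs)]
      have h : (fun (z : (K → ∀ i, P.Priv i) × (∀ i, P.Priv i)) (o : Option K) => o.elim z.2 z.1)
          ⁻¹' Set.univ.pi s = (Set.univ.pi fun k => s (some k)) ×ˢ s none := by
        ext z
        simp [Option.forall, and_comm]
      rw [h, Measure.prod_prod, Measure.pi_pi, Fintype.prod_option, mul_comm]
    exact ((MeasurePreserving.id P.pubLaw).prod hG).comp
      (measurePreserving_prodAssoc P.pubLaw (Measure.pi fun _ : K => Measure.pi P.privLaw)
        (Measure.pi P.privLaw))
  have hhist : ∀ p (ω : Option K → ∀ i, P.Priv i) t k i, P.covHist nb' x' p ω t (some k) i =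
      P.covHist nb x p (fun k => ω (some k)) t k i := by
    intro p ω t
    induction t with
    | zero => intros; rfl
    | succ t ih =>
      intro k i
      simp only [Protocol.covHist]
      rw [ih]
      congr 2
      funext j
      cases hk : nb k i j with
      | none => simp [nb', hk]
      | some k' => simp [nb', hk, ih, x']
  -- The original copies do not depend on the string `d` of the extra copy, so a single good `d`
  -- suffices.
  filter_upwards [Measure.ae_ae_of_ae_prod (hF.quasiMeasurePreserving.ae key)] with z hz
  obtain ⟨d, hd⟩ := hz.exists
  have hout : ∀ t i, (I.val i).isSome → P.covOutput nb' x' (F (z, d)).1 (F (z, d)).2 t (kap' i) i =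
      P.covOutput nb x z.1 z.2 t (kap i) i := by
    intro t i hi
    simp only [Protocol.covOutput, kap', if_pos hi, hhist]
    rfl
  constructor
  · intro i hi
    simpa only [hout _ i hi] using hd.termination i hi
  · intro i j hi hj t t' y y' hy hy'
    rw [← hout t i hi] at hy
    rw [← hout t' j hj] at hy'
    exact hd.agreement i j hi hj t t' y y' hy hy'
  · intro i hi t y hy
    rw [← hout t i hi] at hy
    exact hd.validity i hi t y hy

end Secure

/-! ### Completing two typical samples to a family with prescribed transcripts. -/

section Resampling

variable {K : Type*} [Fintype K] {X : Type*} [MeasurableSpace X] (μ : Measure X)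
  [IsProbabilityMeasure μ]

theorem measurePreserving_update [DecidableEq K] (c : K) :
    MeasurePreserving (fun z : X × (K → X) => Function.update z.2 c z.1)
      (μ.prod (Measure.pi fun _ => μ)) (Measure.pi fun _ => μ) := by
  have hm : Measurable fun z : X × (K → X) => Function.update z.2 c z.1 := by
    refine measurable_pi_lambda _ fun k => ?_
    by_cases h : k = c
    · subst h
      simpa using measurable_fst
    · simp only [Function.update_of_ne h]
      exact (measurable_pi_apply k).comp measurable_snd
  refine ⟨hm, (Measure.pi_eq fun s hs => ?_).symm⟩
  rw [Measure.map_apply hm (.univ_pi hs)]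
  have h : (fun z : X × (K → X) => Function.update z.2 c z.1) ⁻¹' Set.univ.pi s =
      s c ×ˢ Set.univ.pi (Function.update s c Set.univ) := by
    ext z
    simp only [Set.mem_preimage, Set.mem_univ_pi, Set.mem_prod]
    constructor
    · intro h
      refine ⟨by simpa using h c, fun k => ?_⟩
      by_cases hk : k = c
      · subst hk; simp
      · simpa [Function.update_of_ne hk] using h k
    · rintro ⟨h1, h2⟩ k
      by_cases hk : k = c
      · subst hk; simpa using h1
      · simpa [Function.update_of_ne hk] using h2 k
  rw [h, Measure.prod_prod, Measure.pi_pi, ← Finset.mul_prod_erase _ _ (Finset.mem_univ c),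
    ← Finset.mul_prod_erase _ (fun k => μ (s k)) (Finset.mem_univ c)]
  simp only [Function.update_self, measure_univ, one_mul]
  congr 1
  refine Finset.prod_congr rfl fun k hk => ?_
  rw [Function.update_of_ne (Finset.ne_of_mem_erase hk)]

/-- Almost all pairs of samples can be completed to a family of samples that has a given almost
sure property and on which two given countably valued functions are constant on complementary
sets of indices. -/
theorem ae_exists_resample {S S' : Type*} [Countable S] [Countable S'] (f : X → S) (g : X → S')
    {B : K → Prop} {c c' : K} (hc : B c) (hc' : ¬ B c') {Q : (K → X) → Prop}
    (hQ : ∀ᵐ ρ ∂Measure.pi fun _ => μ, Q ρ) :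
    ∀ᵐ a ∂μ, ∀ᵐ b ∂μ, ∃ ρ : K → X, Q ρ ∧ ρ c = a ∧ ρ c' = b ∧
      (∀ k, B k → f (ρ k) = f a) ∧ ∀ k, ¬ B k → g (ρ k) = g b := by
  classical
  have h1 := Measure.ae_ae_of_ae_prod
    ((measurePreserving_update μ c).quasiMeasurePreserving.ae hQ)
  have h2 : ∀ᵐ a ∂μ, ∀ᵐ b ∂μ, ∀ᵐ ρ : K → X ∂Measure.pi fun _ => μ,
      Q (Function.update (Function.update ρ c' b) c a) := by
    filter_upwards [h1] with a ha
    exact Measure.ae_ae_of_ae_prod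
      ((measurePreserving_update μ c').quasiMeasurePreserving.ae ha)
  filter_upwards [h2, ae_measure_fiber_ne_zero f μ] with a ha hfa
  filter_upwards [ha, ae_measure_fiber_ne_zero g μ] with b hb hgb
  -- The prescribed values define a box of finitely many non-null fibers. It has positive measure
  -- and thus meets the almost sure event.
  have hpos : Measure.pi (fun _ : K => μ)
      (Set.univ.pi fun k => if B k then {r | f r = f a} else {r | g r = g b}) ≠ 0 := by
    rw [Measure.pi_pi, Finset.prod_ne_zero_iff]
    intro k _
    split_ifs
    exacts [hfa, hgb]
  obtain ⟨ρ, hρ, hρQ⟩ : ∃ ρ ∈ Set.univ.pi fun k => if B k then {r | f r = f a} else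
      {r | g r = g b}, Q (Function.update (Function.update ρ c' b) c a) := by
    by_contra! hne
    exact hpos (measure_mono_null (fun ρ hρ => hne ρ hρ) hb)
  have hcc : c' ≠ c := fun h => hc' (h ▸ hc)
  have hρ' : ∀ k, (B k → f (ρ k) = f a) ∧ (¬ B k → g (ρ k) = g b) := by
    intro k
    have := hρ k trivial
    by_cases hk : B k <;> simpa [hk] using this
  refine ⟨_, hρQ, by simp, by simp [Function.update_of_ne hcc], fun k hk => ?_, fun k hk => ?_⟩
  · by_cases h : k = c
    · subst h; simp
    · have h' : k ≠ c' := fun h' => hc' (h' ▸ hk)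
      rw [Function.update_of_ne h, Function.update_of_ne h']
      exact (hρ' k).1 hk
  · have h : k ≠ c := fun h => hk (h ▸ hc)
    rw [Function.update_of_ne h]
    by_cases h' : k = c'
    · subst h'; simp
    · rw [Function.update_of_ne h']
      exact (hρ' k).2 hk

end Resampling

/-! ### Executions without corruption, and the speed of influence. -/

section Full

variable {n ts ta Δ : ℕ} {Vin : Type v} {Vout : Type w} (P : Protocol.{u} n Vin Vout)

/-- The histories in the lock-step execution in which all parties follow the protocol. -/
noncomputable def Protocol.fullHist (x : Fin n → Vin) (p : P.Pub) (r : ∀ i, P.Priv i) (t : ℕ)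
    (i : Fin n) : List (Inbox n P.Msg) :=
  P.covHist (fun (_ : Unit) _ _ => some ()) (fun _ => x) p (fun _ => r) t () i

/-- The decisions in the lock-step execution in which all parties follow the protocol. -/
noncomputable def Protocol.fullOutput (x : Fin n → Vin) (p : P.Pub) (r : ∀ i, P.Priv i) (t : ℕ)
    (i : Fin n) : Option Vout :=
  P.output i (x i) p (r i) (P.fullHist x p r t i)

variable {P}

theorem Protocol.fullOutput_mono {x : Fin n → Vin} {p : P.Pub} {r : ∀ i, P.Priv i} {t t' : ℕ}
    (htt : t ≤ t') {i : Fin n} {y : Vout} (h : P.fullOutput x p r t i = some y) :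
    P.fullOutput x p r t' i = some y :=
  Protocol.covOutput_mono (P := P) (nb := fun (_ : Unit) _ _ => some ()) (x := fun _ => x)
    (ω := fun _ => r) (k := ()) htt h

/-- In a region of the cover where all copies of the network have the same history, when run on
their own, this is their history in the cover as well, unless there was time enough for
influence from outside the region. -/
theorem Protocol.covHist_eq_of_window {K : Type*} {nb : K → Fin n → Fin n → Option K}
    {x : K → Fin n → Vin} {x₀ : Fin n → Vin} {p : P.Pub} {ω : K → ∀ i, P.Priv i} {T : ℕ}
    {W : ℕ → K → Prop} {H : ℕ → Fin n → List (Inbox n P.Msg)}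
    (hW : ∀ t k, W (t + 1) k → W t k ∧ ∀ i j, ∃ k', nb k i j = some k' ∧ W t k')
    (hx : ∀ t k, W t k → x k = x₀)
    (hH : ∀ t ≤ T, ∀ s k, W s k → P.fullHist x₀ p (ω k) t = H t)
    (t : ℕ) (ht : t ≤ T) (k : K) (hk : W t k) (i : Fin n) :
    P.covHist nb x p ω t k i = H t i := by
  induction t generalizing k i with
  | zero => rw [← hH 0 ht 0 k hk]; rfl
  | succ t ih =>
    obtain ⟨hk', hnb⟩ := hW t k hk
    rw [← hH (t + 1) ht _ k hk]
    simp only [Protocol.covHist, Protocol.fullHist]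
    congr 1
    · rw [ih (by lia) k hk', ← hH t (by lia) _ k hk']
      rfl
    · congr 1
      funext j
      obtain ⟨k', hkk', hWk'⟩ := hnb i j
      rw [hkk', Option.elim_some, Option.elim_some, ih (by lia) k' hWk', hx t k' hWk']
      -- The private strings of `k` and `k'` may differ, but their full executions have equal
      -- histories. The inbox at step `t + 1` records what `j` sent, so both copies of `j` send `i`
      -- the same.
      have h1 : P.fullHist x₀ p (ω k') (t + 1) i = P.fullHist x₀ p (ω k) (t + 1) i := by
        rw [hH _ ht _ k hk, hH _ ht _ k' hWk']
      simp only [Protocol.covHist, Protocol.fullHist, Option.elim_some] at h1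
      have h2 := congrFun (List.singleton_inj.1 (List.append_inj_right h1 (by
        simp only [Protocol.length_covHist]))) j
      rw [← h2, ← hH t (by lia) _ k' hWk']
      rfl

end Full

/-! ### The ring argument for at least three parties. -/

section Ring

variable {n ts ta Δ : ℕ} {Vin : Type v} {Vout : Type w} {P : Protocol.{u} n Vin Vout}
  {V : ValidityProperty n ts Vin Vout}

/-- The input configuration in which the parties in `hon` are honest and have the inputs `x`. -/
def InputConfig.ofHonest (hon : Fin n → Prop) [DecidablePred hon] (x : Fin n → Vin)
    (h : n ≤ (Finset.univ.filter hon).card + ts) : InputConfig n ts Vin where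
  val i := if hon i then some (x i) else none
  card_honest := by simpa [apply_ite Option.isSome] using h

theorem InputConfig.isSome_ofHonest {hon : Fin n → Prop} [DecidablePred hon] {x : Fin n → Vin}
    {h : n ≤ (Finset.univ.filter hon).card + ts}
    {i : Fin n} : ((InputConfig.ofHonest hon x h).val i).isSome ↔ hon i := by
  by_cases hi : hon i <;> simp [InputConfig.ofHonest, hi]

theorem InputConfig.val_ofHonest {hon : Fin n → Prop} [DecidablePred hon] {x : Fin n → Vin}
    {h : n ≤ (Finset.univ.filter hon).card + ts}
    {i : Fin n} (hi : hon i) : (InputConfig.ofHonest hon x h).val i = some (x i) := by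
  simp [InputConfig.ofHonest, hi]

theorem card_filter_mod_three_ne (hn : n ≤ 3 * ts) (q : ℕ) :
    n ≤ (Finset.univ.filter fun i : Fin n => i.val % 3 ≠ q).card + ts := by
  have h1 : (Finset.univ.filter fun i : Fin n => i.val % 3 = q).card ≤ (Finset.range ts).card := by
    refine Finset.card_le_card_of_injOn (fun i => i.val / 3) (fun i _ => ?_) fun i hi j hj h => ?_
    · have := i.isLt
      simp only [Finset.coe_range, Set.mem_Iio]
      lia
    · simp only [Finset.coe_filter, Finset.mem_univ, true_and, Set.mem_ofPred_eq] at hi hj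
      simp only at h
      exact Fin.ext (by lia)
  have h2 := Finset.card_filter_add_card_filter_not (s := (Finset.univ : Finset (Fin n)))
    (fun i => i.val % 3 = q)
  rw [Finset.card_range] at h1
  rw [Finset.card_univ, Fintype.card_fin] at h2
  change n ≤ (Finset.univ.filter fun i : Fin n => ¬ i.val % 3 = q).card + ts
  lia

/-- The parties are divided into three groups. In the ring, the third group of each copy of the
network is connected with the first group of the next copy. -/
def ringShift (L : ℕ) (i j : Fin n) : ZMod L :=
  if i.val % 3 = 2 ∧ j.val % 3 = 0 then 1
  else if i.val % 3 = 0 ∧ j.val % 3 = 2 then -1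
  else 0

/-- The ring of `L` copies of the network. -/
def ringNb (L : ℕ) (k : ZMod L) (i j : Fin n) : Option (ZMod L) :=
  some (k + ringShift L i j)

theorem ringShift_symm (L : ℕ) (i j : Fin n) : ringShift L j i = - ringShift L i j := by
  unfold ringShift
  split_ifs <;> first | lia | simp

theorem ringNb_symm (L : ℕ) (k : ZMod L) (i j : Fin n) (k' : ZMod L)
    (h : ringNb L k i j = some k') : ringNb L k' j i = some k := by
  obtain rfl := Option.some.inj h
  rw [ringNb, ringShift_symm L i j, add_neg_cancel_right]

/-- The residue class `q` is corrupted, which is affordable as `n ≤ 3 * ts`. The condition on `kap`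
says that the chosen copies of the other two groups are adjacent in the ring. -/
theorem Protocol.IsSecure.ae_ring_coverSecure (hP : P.IsSecure Δ ta V) (hΔ : 0 < Δ)
    (hn : n ≤ 3 * ts) {L : ℕ} [NeZero L] (x : ZMod L → Fin n → Vin) (q : ℕ)
    (kap : Fin n → ZMod L) (hkap : ∀ i j : Fin n, i.val % 3 ≠ q → j.val % 3 ≠ q →
      kap i + ringShift L i j = kap j) :
    ∀ᵐ z ∂P.pubLaw.prod (Measure.pi fun _ : ZMod L => Measure.pi P.privLaw),
      CoverSecure P V (InputConfig.ofHonest (fun i => i.val % 3 ≠ q) (fun i => x (kap i) i)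
        (card_filter_mod_three_ne hn q)) (ringNb L) x kap z.1 z.2 := by
  refine hP.ae_coverSecure hΔ (fun i hi => ?_) (ringNb_symm L) fun i j hi hj => ?_
  · exact InputConfig.val_ofHonest (InputConfig.isSome_ofHonest.1 hi)
  · rw [ringNb, hkap i j (InputConfig.isSome_ofHonest.1 hi) (InputConfig.isSome_ofHonest.1 hj)]

/-- All parties in the ring almost surely decide the same. -/
theorem Protocol.IsSecure.ae_ring_agreement (hP : P.IsSecure Δ ta V) (hΔ : 0 < Δ)
    (hn : n ≤ 3 * ts) (hn3 : 3 ≤ n) {L : ℕ} [NeZero L] (x : ZMod L → Fin n → Vin) :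
    ∀ᵐ z ∂P.pubLaw.prod (Measure.pi fun _ : ZMod L => Measure.pi P.privLaw),
      ∀ (i : Fin n), i.val = 0 → ∀ m m' : ℕ, ∀ t t' y y',
        P.covOutput (ringNb L) x z.1 z.2 t (m : ZMod L) i = some y →
        P.covOutput (ringNb L) x z.1 z.2 t' (m' : ZMod L) i = some y' → y = y' := by
  have h01 : ∀ᵐ z ∂P.pubLaw.prod (Measure.pi fun _ : ZMod L => Measure.pi P.privLaw),
      ∀ k, _ := ae_all_iff.2 fun k : ZMod L =>
    hP.ae_ring_coverSecure hΔ hn x 2 (fun _ => k) (by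
      intro i j hi hj
      rw [ringShift, if_neg (by lia), if_neg (by lia), add_zero])
  have h12 : ∀ᵐ z ∂P.pubLaw.prod (Measure.pi fun _ : ZMod L => Measure.pi P.privLaw),
      ∀ k, _ := ae_all_iff.2 fun k : ZMod L =>
    hP.ae_ring_coverSecure hΔ hn x 0 (fun _ => k) (by
      intro i j hi hj
      rw [ringShift, if_neg (by lia), if_neg (by lia), add_zero])
  -- The only pair that crosses a seam: the third group of copy `k` and the first group of copy `k +
  -- 1`.
  have h20 : ∀ᵐ z ∂P.pubLaw.prod (Measure.pi fun _ : ZMod L => Measure.pi P.privLaw),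
      ∀ k, _ := ae_all_iff.2 fun k : ZMod L =>
    hP.ae_ring_coverSecure hΔ hn x 1 (fun i => if i.val % 3 = 2 then k else k + 1) (by
      intro i j hi hj
      have hi' : i.val % 3 = 0 ∨ i.val % 3 = 2 := by lia
      have hj' : j.val % 3 = 0 ∨ j.val % 3 = 2 := by lia
      rcases hi' with hi' | hi' <;> rcases hj' with hj' | hj' <;> simp [ringShift, hi', hj'])
  filter_upwards [h01, h12, h20] with z h01 h12 h20 i hi
  let Dec : ZMod L → Fin n → Vout → Prop := fun k i y =>
    ∃ t, P.covOutput (ringNb L) x z.1 z.2 t k i = some y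
  let i1 : Fin n := ⟨1, by lia⟩
  let i2 : Fin n := ⟨2, by lia⟩
  have e0 : i.val % 3 = 0 := by lia
  have e1 : i1.val % 3 = 1 := rfl
  have e2 : i2.val % 3 = 2 := rfl
  have agr : ∀ {q : ℕ} {kap : Fin n → ZMod L},
      CoverSecure P V (InputConfig.ofHonest (fun i => i.val % 3 ≠ q) (fun i => x (kap i) i)
        (card_filter_mod_three_ne hn q)) (ringNb L) x kap z.1 z.2 →
      ∀ a b : Fin n, a.val % 3 ≠ q → b.val % 3 ≠ q → ∀ y y', Dec (kap a) a y → Dec (kap b) b y' →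
      y = y' := by
    rintro q kap h a b ha hb y y' ⟨t, hy⟩ ⟨t', hy'⟩
    exact h.agreement a b (InputConfig.isSome_ofHonest.2 ha) (InputConfig.isSome_ofHonest.2 hb)
      t t' y y' hy hy'
  have dec : ∀ {q : ℕ} {kap : Fin n → ZMod L},
      CoverSecure P V (InputConfig.ofHonest (fun i => i.val % 3 ≠ q) (fun i => x (kap i) i)
        (card_filter_mod_three_ne hn q)) (ringNb L) x kap z.1 z.2 →
      ∀ a : Fin n, a.val % 3 ≠ q → ∃ y, Dec (kap a) a y := by
    intro q kap h a ha
    obtain ⟨t, y, hy⟩ := h.termination a (InputConfig.isSome_ofHonest.2 ha)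
    exact ⟨y, t, hy⟩
  have step : ∀ k y y', Dec k i y → Dec (k + 1) i y' → y = y' := by
    intro k y y' hy hy'
    obtain ⟨y1, hy1⟩ := dec (h01 k) i1 (by lia)
    obtain ⟨y2, hy2⟩ := dec (h12 k) i2 (by lia)
    rw [agr (h01 k) i i1 (by lia) (by lia) y y1 hy hy1,
      agr (h12 k) i1 i2 (by lia) (by lia) y1 y2 hy1 hy2]
    exact agr (h20 k) i2 i (by lia) (by lia) y2 y' (by simpa [e2] using hy2)
      (by simpa [e0] using hy')
  obtain ⟨y₀, hy₀⟩ := dec (h01 ((0 : ℕ) : ZMod L)) i (by lia)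
  have all : ∀ m : ℕ, ∀ y, Dec (m : ZMod L) i y → y₀ = y := by
    intro m
    induction m with
    | zero => exact fun y hy => agr (h01 _) i i (by lia) (by lia) _ _ hy₀ hy
    | succ m ih =>
      intro y hy
      obtain ⟨y1, hy1⟩ := dec (h01 (m : ZMod L)) i (by lia)
      rw [ih y1 hy1]
      exact step _ _ _ hy1 (by simpa using hy)
  intro m m' t t' y y' hy hy'
  rw [← all m y ⟨t, hy⟩, ← all m' y' ⟨t', hy'⟩]

/-- The copies in the ring whose distance from the ends of the segment from `a` to `b` is at
least `t`. -/
def ringWindow (L a b t : ℕ) (k : ZMod L) : Prop :=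
  ∃ m : ℕ, k = m ∧ a + t ≤ m ∧ m + t ≤ b

theorem ringWindow_succ {L a b t : ℕ} {k : ZMod L} (h : ringWindow L a b (t + 1) k) :
    ringWindow L a b t k ∧
      ∀ i j : Fin n, ∃ k', ringNb L k i j = some k' ∧ ringWindow L a b t k' := by
  obtain ⟨m, rfl, h1, h2⟩ := h
  refine ⟨⟨m, rfl, by lia, by lia⟩, fun i j => ⟨_, rfl, ?_⟩⟩
  unfold ringShift
  split_ifs
  · exact ⟨m + 1, by push_cast; rfl, by lia, by lia⟩
  · exact ⟨m - 1, by rw [Nat.cast_sub (by lia)]; push_cast; ring, by lia, by lia⟩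
  · exact ⟨m, by simp, by lia, by lia⟩

/-- What the first party decides in the execution without corrupted parties does not depend on
the inputs and on the private randomness. -/
theorem Protocol.IsSecure.ae_fullOutput_agreement (hP : P.IsSecure Δ ta V) (hΔ : 0 < Δ)
    (hn : n ≤ 3 * ts) (hn3 : 3 ≤ n) (x x' : Fin n → Vin) (T : ℕ) (i : Fin n) (hi : i.val = 0) :
    ∀ᵐ p ∂P.pubLaw, ∀ᵐ r ∂Measure.pi P.privLaw, ∀ᵐ r' ∂Measure.pi P.privLaw, ∀ y y',
      P.fullOutput x p r T i = some y → P.fullOutput x' p r' T i = some y' → y = y' := by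
  -- Two segments of `2 * T + 1` copies, with midpoints `T` and `3 * T + 1`, each at distance `T`
  -- from the ends of its segment.
  let L := 4 * T + 2
  have : NeZero L := ⟨by lia⟩
  let B : ZMod L → Prop := fun k => k.val ≤ 2 * T
  classical
  let X : ZMod L → Fin n → Vin := fun k => if B k then x else x'
  have hval : ∀ m : ℕ, m < L → ((m : ZMod L)).val = m := fun m hm => ZMod.val_natCast_of_lt hm
  have hc : B ((T : ℕ) : ZMod L) := by
    change ZMod.val _ ≤ _
    rw [hval T (by lia)]; lia
  have hc' : ¬ B ((3 * T + 1 : ℕ) : ZMod L) := by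
    change ¬ ZMod.val _ ≤ _
    rw [hval _ (by lia)]; lia
  have hB : ∀ t k, ringWindow L 0 (2 * T) t k → B k := by
    rintro t k ⟨m, rfl, h1, h2⟩
    change ZMod.val _ ≤ _
    rw [hval m (by lia)]; lia
  have hB' : ∀ t k, ringWindow L (2 * T + 1) (4 * T + 1) t k → ¬ B k := by
    rintro t k ⟨m, rfl, h1, h2⟩
    change ¬ ZMod.val _ ≤ _
    rw [hval m (by lia)]; lia
  filter_upwards [Measure.ae_ae_of_ae_prod (hP.ae_ring_agreement hΔ hn hn3 X)] with p hp
  -- The resampled data are the complete transcripts of all parties up to time `T`, a countable set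
  -- of values.
  have hres := ae_exists_resample (Measure.pi P.privLaw)
    (fun r (t : Fin (T + 1)) i => P.fullHist x p r t i)
    (fun r (t : Fin (T + 1)) i => P.fullHist x' p r t i) hc hc' hp
  filter_upwards [hres] with r hr
  filter_upwards [hr] with r' hr' y y' hy hy'
  obtain ⟨ω, hω, hωr, hωr', hf, hg⟩ := hr'
  have hist1 := Protocol.covHist_eq_of_window (P := P) (nb := ringNb L) (x := X) (x₀ := x)
    (p := p) (ω := ω) (T := T) (W := ringWindow L 0 (2 * T)) (H := P.fullHist x p r)
    (fun t k h => ringWindow_succ h) (fun t k h => if_pos (hB t k h))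
    (fun t ht s k h => congrFun (hf k (hB s k h)) ⟨t, by lia⟩) T le_rfl (T : ℕ)
    ⟨T, rfl, by lia, by lia⟩ i
  have hist2 := Protocol.covHist_eq_of_window (P := P) (nb := ringNb L) (x := X) (x₀ := x')
    (p := p) (ω := ω) (T := T) (W := ringWindow L (2 * T + 1) (4 * T + 1))
    (H := P.fullHist x' p r')
    (fun t k h => ringWindow_succ h) (fun t k h => if_neg (hB' t k h))
    (fun t ht s k h => congrFun (hg k (hB' s k h)) ⟨t, by lia⟩) T le_rfl ((3 * T + 1 : ℕ))
    ⟨3 * T + 1, rfl, by lia, by lia⟩ i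
  refine hω i hi T (3 * T + 1) T T y y' ?_ ?_
  · rw [Protocol.covOutput, hist1, hωr, ← hy]
    simp only [X, if_pos hc]
    rfl
  · rw [Protocol.covOutput, hist2, hωr', ← hy']
    simp only [X, if_neg hc']
    rfl

theorem InputConfig.exists_isSome (htn : ts < n) (I : InputConfig n ts Vin) :
    ∃ i, (I.val i).isSome := by
  have h := I.card_honest
  have h' : 0 < (Finset.univ.filter fun i => (I.val i).isSome).card := by lia
  obtain ⟨i, hi⟩ := Finset.card_pos.1 h'
  exact ⟨i, (Finset.mem_filter.1 hi).2⟩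

instance InputConfig.countable [Countable Vin] : Countable (InputConfig n ts Vin) := by
  refine Function.Injective.countable (f := InputConfig.val) ?_
  rintro ⟨a, _⟩ ⟨b, _⟩ rfl
  rfl

/-- The corrupted parties of `I` may follow the protocol with the inputs in `x`. The same execution
can therefore be judged by several configurations. -/
theorem Protocol.IsSecure.ae_coverSecure_full (hP : P.IsSecure Δ ta V) (hΔ : 0 < Δ)
    (I : InputConfig n ts Vin) (x : Fin n → Vin)
    (hI : ∀ i, (I.val i).isSome → I.val i = some (x i)) :
    ∀ᵐ p ∂P.pubLaw, ∀ᵐ r ∂Measure.pi P.privLaw,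
      CoverSecure P V I (fun (_ : Unit) _ _ => some ()) (fun _ => x) (fun _ => ()) p
        fun _ => r := by
  have h := hP.ae_coverSecure hΔ (nb := fun (_ : Unit) _ _ => some ()) (x := fun _ => x)
    (kap := fun _ => ()) (I := I) hI (fun _ _ _ _ _ => rfl) fun _ _ _ _ => rfl
  filter_upwards [Measure.ae_ae_of_ae_prod h] with p hp
  exact (measurePreserving_piUnique fun _ : Unit => Measure.pi P.privLaw).symm
    |>.quasiMeasurePreserving.ae hp

theorem Protocol.IsSecure.isTrivial_of_three_le [Countable Vin] [Nonempty Vin]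
    (hP : P.IsSecure Δ ta V) (hΔ : 0 < Δ) (htn : ts < n) (hn : n ≤ 3 * ts) (hn3 : 3 ≤ n) :
    V.IsTrivial := by
  classical
  obtain ⟨d⟩ := ‹Nonempty Vin›
  let i0 : Fin n := ⟨0, by lia⟩
  let ext : InputConfig n ts Vin → Fin n → Vin := fun I i => (I.val i).getD d
  have hext : ∀ (I : InputConfig n ts Vin) i, (I.val i).isSome → I.val i = some (ext I i) := by
    intro I i hi
    obtain ⟨a, ha⟩ := Option.isSome_iff_exists.1 hi
    simp [ext, ha]
  let full : (Fin n → Vin) → InputConfig n ts Vin := fun x =>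
    InputConfig.ofHonest (fun _ => True) x (by simp)
  have hfull : ∀ x i, ((full x).val i).isSome := fun x i =>
    InputConfig.isSome_ofHonest.2 trivial
  have hfull' : ∀ x i, ((full x).val i).isSome → (full x).val i = some (x i) := fun x i _ =>
    InputConfig.val_ofHonest trivial
  let x₀ : Fin n → Vin := fun _ => d
  have h1 : ∀ᵐ p ∂P.pubLaw, ∀ I : InputConfig n ts Vin, _ :=
    ae_all_iff.2 fun I : InputConfig n ts Vin => hP.ae_coverSecure_full hΔ I (ext I) (hext I)
  have h2 : ∀ᵐ p ∂P.pubLaw, ∀ I : InputConfig n ts Vin, _ :=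
    ae_all_iff.2 fun I : InputConfig n ts Vin =>
      hP.ae_coverSecure_full hΔ (full (ext I)) (ext I) (hfull' _)
  have h3 := hP.ae_coverSecure_full hΔ (full x₀) x₀ (hfull' _)
  have h4 : ∀ᵐ p ∂P.pubLaw, ∀ (I : InputConfig n ts Vin) (T : ℕ), _ :=
    ae_all_iff.2 fun I : InputConfig n ts Vin => ae_all_iff.2 fun T : ℕ =>
      hP.ae_fullOutput_agreement hΔ hn hn3 x₀ (ext I) T i0 rfl
  obtain ⟨p, h1, h2, h3, h4⟩ := (h1.and (h2.and (h3.and h4))).exists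
  have h4' : ∀ᵐ r ∂Measure.pi P.privLaw, ∀ (I : InputConfig n ts Vin) (T : ℕ), _ :=
    ae_all_iff.2 fun I => ae_all_iff.2 fun T => h4 I T
  obtain ⟨r, h3, h4⟩ := (h3.and h4').exists
  obtain ⟨t, y, hy⟩ := h3.termination i0 (hfull _ _)
  refine ⟨y, Set.mem_iInter.2 fun I => ?_⟩
  obtain ⟨r', h1, h2, h4⟩ := ((h1 I).and ((h2 I).and (ae_all_iff.2 (h4 I)))).exists
  obtain ⟨t', y', hy'⟩ := h2.termination i0 (hfull _ _)
  obtain ⟨i, hi⟩ := I.exists_isSome htn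
  obtain ⟨s, z, hz⟩ := h1.termination i hi
  -- Party `i0` may be corrupted in `I`. Agreement in the fully honest configuration carries its
  -- value to an honest party `i` of `I`, and validity for `I` applies there.
  have e1 : y = y' := h4 (max t t') y y' (Protocol.fullOutput_mono (le_max_left _ _) hy)
    (Protocol.fullOutput_mono (le_max_right _ _) hy')
  have e2 : y' = z := h2.agreement i0 i (hfull _ _) (hfull _ _) t' s y' z hy' hz
  rw [e1, e2]
  exact h1.validity i hi s z hz

end Ring

/-! ### The delay argument for two parties. -/

section Delay

variable {n ts ta Δ : ℕ} {Vin : Type v} {Vout : Type w} {P : Protocol.{u} n Vin Vout}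
  {V : ValidityProperty n ts Vin Vout}

/-- The adversary that, up to time `T`, delays all messages between different parties. -/
noncomputable def delayAdversary (P : Protocol.{u} n Vin Vout) (T : ℕ) : Adversary P where
  Coin := PUnit
  coinLaw := Measure.dirac PUnit.unit
  active _ _ _ _ := True
  -- Messages of a party to itself are not delayed, matching the self-links of `aloneNb`; from tick
  -- `T` on everything is delivered, so the schedule is asynchronous.
  deliver _ _ seen _ j i := j = i ∨ T ≤ seen.length
  byz _ _ _ _ _ := none
  measurableSet_active _ _ := MeasurableSet.univ
  measurableSet_deliver _ _ _ _ := MeasurableSet.const _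
  measurableSet_byz _ _ _ _ := MeasurableSet.const _

theorem Adversary.length_seen_run (A : Adversary P) (I : InputConfig n ts Vin) (ω : A.Sample)
    (t : ℕ) : (A.run I ω t).seen.length = t := by
  induction t with
  | zero => rfl
  | succ t ih => simp [Adversary.run, Adversary.tick, ih]

theorem delayAdversary_isAsynchronous (T : ℕ) (I : InputConfig n ts Vin) :
    (delayAdversary P T).IsAsynchronous I := by
  refine fun ω i _ => ⟨fun t₀ => ⟨t₀, le_rfl, trivial⟩, fun s j =>
    ⟨max (s + 1) T, lt_of_lt_of_le (Nat.lt_succ_self s) (le_max_left _ _), trivial, Or.inr ?_⟩⟩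
  rw [Adversary.length_seen_run]
  exact le_max_right _ _

/-- The network in which every party is alone. -/
def aloneNb (_ : Unit) (i j : Fin n) : Option Unit :=
  if i = j then some () else none

theorem aloneNb_symm (k : Unit) (i j : Fin n) (k' : Unit) (h : aloneNb k i j = some k') :
    aloneNb k' j i = some k := by
  unfold aloneNb at h ⊢
  by_cases hij : i = j
  · rw [if_pos hij.symm]
  · rw [if_neg hij] at h
    cases h

/-- The decisions of parties that receive no messages but their own. -/
noncomputable def Protocol.aloneOutput (P : Protocol.{u} n Vin Vout) (x : Fin n → Vin) (p : P.Pub)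
    (r : ∀ i, P.Priv i) (t : ℕ) (i : Fin n) : Option Vout :=
  P.covOutput aloneNb (fun _ => x) p (fun _ => r) t () i

theorem Protocol.covHist_aloneNb_congr {x x' : Fin n → Vin} {i : Fin n} (h : x i = x' i)
    (p : P.Pub) (r : ∀ i, P.Priv i) (t : ℕ) :
    P.covHist aloneNb (fun _ => x) p (fun _ => r) t () i =
      P.covHist aloneNb (fun _ => x') p (fun _ => r) t () i := by
  induction t with
  | zero => rfl
  | succ t ih =>
    simp only [Protocol.covHist]
    rw [ih]
    congr 2
    funext j
    by_cases hij : i = j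
    · subst hij
      simp [aloneNb, ih, h]
    · simp [aloneNb, hij]

theorem Protocol.aloneOutput_congr {x x' : Fin n → Vin} {i : Fin n} (h : x i = x' i)
    (p : P.Pub) (r : ∀ i, P.Priv i) (t : ℕ) :
    P.aloneOutput x p r t i = P.aloneOutput x' p r t i := by
  unfold Protocol.aloneOutput Protocol.covOutput
  simp only [Protocol.covHist_aloneNb_congr h, h]

theorem run_delayAdversary {T : ℕ} {I : InputConfig n ts Vin} {x : Fin n → Vin}
    (hI : ∀ i, I.val i = some (x i)) (ω : (delayAdversary P T).Sample) (t : ℕ) (ht : t ≤ T) :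
    let g := (delayAdversary P T).run I ω t
    (∀ i, g.hist i = P.covHist aloneNb (fun _ => x) ω.1 (fun _ => ω.2.1) t () i) ∧
    ∀ s i, g.transit s i i = if s + 1 = t then P.send i (x i) ω.1 (ω.2.1 i)
      (P.covHist aloneNb (fun _ => x) ω.1 (fun _ => ω.2.1) t () i) i else none := by
  classical
  induction t with
  | zero => simp [Adversary.run, Protocol.covHist]
  | succ t ih =>
    intro g
    obtain ⟨ih1, ih2⟩ := ih (by lia)
    have hlen := (delayAdversary P T).length_seen_run I ω t
    set g₀ := (delayAdversary P T).run I ω t with hg₀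
    have hg : g = (delayAdversary P T).tick I ω t g₀ := rfl
    have hdel : ∀ s j i, (delayAdversary P T).deliver ω.1 ω.2.2 g₀.seen s j i ↔ j = i := by
      intro s j i
      change (j = i ∨ T ≤ g₀.seen.length) ↔ j = i
      exact or_iff_left (by lia)
    have hhist : ∀ i, g.hist i =
        P.covHist aloneNb (fun _ => x) ω.1 (fun _ => ω.2.1) (t + 1) () i := by
      intro i
      have h : g.hist i = g₀.hist i ++ [fun j => ∑ s ∈ Finset.range t,
          if j = i then (g₀.transit s j i).elim 0 fun m => {m} else 0] := by
        refine (if_pos trivial).trans ?_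
        congr 2
        funext j
        exact Finset.sum_congr rfl fun s _ => if_congr (hdel s j i) rfl rfl
      rw [h, ih1 i, Protocol.covHist]
      congr 2
      funext j
      by_cases hij : j = i
      · subst hij
        simp only [if_true, aloneNb, Option.elim_some, ih2]
        cases t with
        | zero => simp [Protocol.delivery, Protocol.covHist]
        | succ t =>
          rw [Finset.sum_range_succ, Finset.sum_eq_zero, zero_add, if_pos rfl]
          · have hne : P.covHist aloneNb (fun _ => x) ω.1 (fun _ => ω.2.1) (t + 1) () j ≠ [] := by
              simp [Protocol.covHist]
            simp only [Protocol.delivery, if_neg hne]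
          · intro s hs
            have := Finset.mem_range.1 hs
            rw [if_neg (by lia)]
            rfl
      · simp [hij, aloneNb, Ne.symm hij]
    refine ⟨hhist, fun s i => ?_⟩
    by_cases hs : s = t
    · subst hs
      rw [if_pos rfl, ← hhist, hg]
      simp only [Adversary.tick, hI i, Option.isSome_some, if_true]
      exact (if_pos trivial).trans rfl
    · rw [if_neg (by lia), hg]
      simp only [Adversary.tick, if_neg hs]
      exact if_pos ⟨trivial, (hdel s i i).2 rfl⟩

/-- If nobody is corrupted, the parties almost surely agree on a valid output even if they decide
before they have heard from each other. -/
theorem Protocol.IsSecure.ae_aloneOutput (hP : P.IsSecure Δ ta V) (I : InputConfig n ts Vin)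
    (x : Fin n → Vin) (hI : ∀ i, I.val i = some (x i)) (T : ℕ) :
    ∀ᵐ p ∂P.pubLaw, ∀ᵐ r ∂Measure.pi P.privLaw, ∀ i j y y',
      P.aloneOutput x p r T i = some y → P.aloneOutput x p r T j = some y' →
      y = y' ∧ y ∈ V I := by
  have hA := hP.asynchronous I (delayAdversary P T) (by simp [hI])
    (delayAdversary_isAsynchronous T I)
  have hout : ∀ (ω : (delayAdversary P T).Sample) i,
      (delayAdversary P T).outputAt I ω T i (x i) = P.aloneOutput x ω.1 ω.2.1 T i := by
    intro ω i
    rw [Adversary.outputAt, (run_delayAdversary hI ω T le_rfl).1 i]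
    rfl
  filter_upwards [Measure.ae_ae_of_ae_prod (hA.agreement.and hA.validity)] with p hp
  filter_upwards [Measure.ae_ae_of_ae_prod hp] with r hr i j y y' hy hy'
  obtain ⟨c, h1, h2⟩ := hr.exists
  rw [← hout (p, r, c)] at hy hy'
  exact ⟨h1 i _ j _ T T y y' (hI i) (hI j) hy hy', h2 i _ T y (hI i) hy⟩

/-- A sole honest party faces silent corrupted parties in a synchronous network, so it must decide
without hearing from anyone else. -/
theorem Protocol.IsSecure.ae_coverSecure_alone (hP : P.IsSecure Δ ta V) (hΔ : 0 < Δ)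
    (I : InputConfig n ts Vin) (x : Fin n → Vin)
    (hI : ∀ i, (I.val i).isSome → I.val i = some (x i)) :
    ∀ᵐ p ∂P.pubLaw, ∀ᵐ r ∂Measure.pi P.privLaw,
      (∀ i j, (I.val i).isSome → (I.val j).isSome → i = j) →
      CoverSecure P V I aloneNb (fun _ => x) (fun _ => ()) p fun _ => r := by
  by_cases hone : ∀ i j, (I.val i).isSome → (I.val j).isSome → i = j
  · have h := hP.ae_coverSecure hΔ (nb := aloneNb) (x := fun _ => x)
      (kap := fun _ => ()) (I := I) hI aloneNb_symm fun i j hi hj => by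
        rw [hone i j hi hj]
        exact if_pos rfl
    filter_upwards [Measure.ae_ae_of_ae_prod h] with p hp
    have h' := (measurePreserving_piUnique fun _ : Unit => Measure.pi P.privLaw).symm
      |>.quasiMeasurePreserving.ae hp
    filter_upwards [h'] with r hr _
    exact hr
  · exact .of_forall fun p => .of_forall fun r h => absurd h hone

theorem Protocol.IsSecure.isTrivial_of_eq_two [Countable Vin] [Nonempty Vin]
    (hP : P.IsSecure Δ ta V) (hΔ : 0 < Δ) (hts : 0 < ts) (htn : ts < n) (hn2 : n = 2) :
    V.IsTrivial := by
  classical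
  obtain ⟨d⟩ := ‹Nonempty Vin›
  let ext : InputConfig n ts Vin → Fin n → Vin := fun I i => (I.val i).getD d
  have hext : ∀ (I : InputConfig n ts Vin) i, (I.val i).isSome → I.val i = some (ext I i) := by
    intro I i hi
    obtain ⟨a, ha⟩ := Option.isSome_iff_exists.1 hi
    simp [ext, ha]
  let full : (Fin n → Vin) → InputConfig n ts Vin := fun x =>
    InputConfig.ofHonest (fun _ => True) x (by simp)
  let single : Fin n → (Fin n → Vin) → InputConfig n ts Vin := fun a x =>
    InputConfig.ofHonest (fun i => i = a) x (by
      rw [Finset.filter_eq' Finset.univ a, if_pos (Finset.mem_univ a), Finset.card_singleton]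
      lia)
  have h1 : ∀ᵐ p ∂P.pubLaw, ∀ I : InputConfig n ts Vin, _ :=
    ae_all_iff.2 fun I : InputConfig n ts Vin => hP.ae_coverSecure_alone hΔ I (ext I) (hext I)
  have h2 : ∀ᵐ p ∂P.pubLaw, ∀ (x : Fin n → Vin) (T : ℕ), _ :=
    ae_all_iff.2 fun x : Fin n → Vin => ae_all_iff.2 fun T : ℕ =>
      hP.ae_aloneOutput (full x) x (fun i => InputConfig.val_ofHonest trivial) T
  obtain ⟨p, h1, h2⟩ := (h1.and h2).exists
  obtain ⟨r, h1, h2⟩ := ((ae_all_iff.2 h1).and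
    (ae_all_iff.2 fun x => ae_all_iff.2 fun T => h2 x T)).exists
  have dec : ∀ x a, ∃ t y, P.aloneOutput x p r t a = some y := by
    intro x a
    have hs : ∀ i, ((single a x).val i).isSome ↔ i = a := fun i => InputConfig.isSome_ofHonest
    obtain ⟨t, y, hy⟩ := (h1 (single a x) fun i j hi hj =>
      ((hs i).1 hi).trans ((hs j).1 hj).symm).termination a ((hs a).2 rfl)
    refine ⟨t, y, ?_⟩
    rw [← hy]
    refine Protocol.aloneOutput_congr ?_ p r t
    simp [ext, single, InputConfig.ofHonest]
  have agr : ∀ x a b t t' y y', P.aloneOutput x p r t a = some y →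
      P.aloneOutput x p r t' b = some y' → y = y' ∧ y ∈ V (full x) := by
    intro x a b t t' y y' hy hy'
    exact h2 x (max t t') a b y y' (Protocol.covOutput_mono (le_max_left _ _) hy)
      (Protocol.covOutput_mono (le_max_right _ _) hy')
  let i0 : Fin n := ⟨0, by lia⟩
  let i1 : Fin n := ⟨1, by lia⟩
  have h01 : i1 ≠ i0 := fun h => one_ne_zero (congrArg Fin.val h)
  obtain ⟨t₀, y₀, hy₀⟩ := dec (fun _ => d) i0
  have key : ∀ x a t y, P.aloneOutput x p r t a = some y → y₀ = y := by
    intro x a t y hy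
    -- A hybrid: party `0` decides as with the reference inputs, party `1` as with `x`, and both are
    -- honest, so the two decisions coincide.
    let x' : Fin n → Vin := Function.update x i0 d
    obtain ⟨t', y', hy'⟩ := dec x i1
    have e1 : P.aloneOutput x' p r t₀ i0 = some y₀ := by
      rw [← hy₀]
      exact Protocol.aloneOutput_congr (by simp [x']) p r t₀
    have e2 : P.aloneOutput x' p r t' i1 = some y' := by
      rw [← hy']
      exact Protocol.aloneOutput_congr (by simp [x', Function.update_of_ne h01]) p r t'
    exact (agr x' i0 i1 t₀ t' y₀ y' e1 e2).1.trans (agr x i1 a t' t y' y hy' hy).1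
  refine ⟨y₀, Set.mem_iInter.2 fun I => ?_⟩
  by_cases hall : ∀ i, (I.val i).isSome
  · have hI : full (ext I) = I := by
      have hval : (full (ext I)).val = I.val :=
        funext fun i => (InputConfig.val_ofHonest trivial).trans (hext I i (hall i)).symm
      obtain ⟨a, ha⟩ := I
      change InputConfig.mk _ _ = _
      congr
    obtain ⟨t, y, hy⟩ := dec (ext I) i0
    rw [key _ _ _ _ hy]
    have h := (agr (ext I) i0 i0 t t y y hy hy).2
    rwa [hI] at h
  -- With two parties, one of them corrupted, at most one is honest, so validity for `I` covers its
  -- lone decision.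
  · obtain ⟨j, hj⟩ := not_forall.1 hall
    obtain ⟨i, hi⟩ := I.exists_isSome htn
    have h := h1 I fun a b ha hb => by
      have haj : a ≠ j := fun h => hj (h ▸ ha)
      have hbj : b ≠ j := fun h => hj (h ▸ hb)
      have := Fin.val_ne_of_ne haj
      have := Fin.val_ne_of_ne hbj
      exact Fin.ext (by lia)
    obtain ⟨t, y, hy⟩ := h.termination i hi
    rw [key _ _ _ _ hy]
    exact h.validity i hi t y hy

end Delay

end NetworkAgnostic

theorem mainTheorem7 {Vin : Type*} {Vout : Type*} [Countable Vin] [Nonempty Vin]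
    (n ts ta Δ : ℕ) (hΔ : 0 < Δ) (hts : 0 < ts) (hta : ta ≤ ts) (htn : ts < n) (hn : n ≤ 3 * ts)
    (V : NetworkAgnostic.ValidityProperty n ts Vin Vout)
    (hV : ∃ P : NetworkAgnostic.Protocol n Vin Vout, P.IsSecure Δ ta V) :
    V.IsTrivial := by
  obtain ⟨P, hP⟩ := hV
  -- Below three parties `0 < ts < n` forces `n = 2`. Then the third group is empty and the chain of
  -- agreements around the ring breaks.
  rcases Nat.lt_or_ge n 3 with h | h
  · exact hP.isTrivial_of_eq_two hΔ hts htn (by lia)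
  · exact hP.isTrivial_of_three_le hΔ htn hn h
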